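/- All graphs are on finite vertex sets. A partially directed graph has undirected edges and arcs, at most one of these between any two distinct vertices; $P[W]$ is its subgraph induced by a vertex set $W$. Two directed acyclic graphs (DAGs) on the same vertex set are Markov equivalent if they encode the same conditional independences, i.e. have the same d-separations $X \perp Y \mid Z$ for pairwise disjoint vertex sets $X, Y, Z$. For a DAG $G$ on $V$ and an intervention $S \subseteq V$, let $G_S$ be the DAG obtained from $G$ by deleting all arcs into vertices of $S$. For an intervention set $\mathcal{I} \subseteq 2^V$, two DAGs $G, G'$ on $V$ are $\mathcal{I}$-Markov equivalent if $G, G'$ are Markov equivalent (observational data are always available) and $G_S, G'_S$ are Markov equivalent for every $S \in \mathcal{I}$. The $\mathcal{I}$-essential graph $\mathcal{E}_{\mathcal{I}}(G)$ is the partially directed graph on $V$ with an arc $u \to v$ if every DAG $\mathcal{I}$-Markov equivalent to $G$ has the arc $u \to v$, and an undirected edge between $u$ and $v$ if some such DAG has $u \to v$ and some such DAG has $v \to u$. Its chain components are the connected components of the undirected graph obtained by removing all its arcs. **Lemma.** Let $G^*$ be a DAG on $V$, let $\mathcal{I} \subseteq 2^V$ be an intervention set, and let $H$ be a chain component of $\mathcal{E}_{\mathcal{I}}(G^*)$,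 with vertex set $V(H)$. Then for every $\mathcal{I}' \subseteq 2^V$ with $\mathcal{I} \cap \mathcal{I}' = \emptyset$, $$\mathcal{E}_{\mathcal{I} \cup \mathcal{I}'}(G^*)[V(H)] = \mathcal{E}_{\{S \cap V(H) \,:\, S \in \mathcal{I}'\}}(G^*[V(H)]),$$ an equality of partially directed graphs on $V(H)$. -/

import Mathlib

/-- A partially directed graph: undirected edges and arcs, where any two distinct vertices are joined
by an undirected edge, or by an arc in exactly one direction, or not at all. -/
@[ext]
structure PDGraph (V : Type*) where
  /-- the graph of the undirected edges -/
  und : SimpleGraph V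
  /-- `arc u v` means `u → v` -/
  arc : V → V → Prop
  arc_asymm : ∀ u v, arc u v → ¬ arc v u
  arc_not_und : ∀ u v, arc u v → ¬ und.Adj u v

namespace PDGraph

variable {V : Type*}

/-- The vertex-induced subgraph. -/
def induce (P : PDGraph V) (s : Set V) : PDGraph s where
  und := P.und.induce s
  arc u v := P.arc u v
  arc_asymm u v h := P.arc_asymm u v h
  arc_not_und u v h := P.arc_not_und u v h

/-- The chain components: the connected components of the undirected graph that remains
when all arcs are removed. The vertex set of `H` is `H.supp`. -/
abbrev ChainComponent (P : PDGraph V) : Type _ := P.und.ConnectedComponent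

end PDGraph

/-- A directed acyclic graph. -/
@[ext]
structure DAG (V : Type*) where
  /-- `arc u v` means `u → v` -/
  arc : V → V → Prop
  acyclic : ∀ v, ¬ Relation.TransGen arc v v

namespace DAG

variable {V : Type*}

/-- The vertex-induced subgraph `G[s]`. -/
def induce (G : DAG V) (s : Set V) : DAG s where
  arc u v := G.arc u v
  acyclic v h := G.acyclic v (Relation.TransGen.lift Subtype.val (fun _ _ hab => hab) _ _ h)

/-- The interventional graph `G_S` of an ideal intervention on `S`:
all arcs into vertices of `S` are removed. -/
def intervene (G : DAG V) (S : Set V) : DAG V where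
  arc u v := G.arc u v ∧ v ∉ S
  acyclic v h := G.acyclic v (Relation.TransGen.mono (fun _ _ hab => hab.1) _ _ h)

/-- Adjacency in the skeleton. -/
def Adj (G : DAG V) (u v : V) : Prop := G.arc u v ∨ G.arc v u

/-- `G.Collider a b c` : `a → b ← c`. -/
def Collider (G : DAG V) (a b c : V) : Prop := G.arc a b ∧ G.arc c b

/-- `l` is a trail (a sequence of consecutively adjacent vertices) from `x` to `y` that is active
given `Z`: each collider on it has a descendant (possibly itself) in `Z`, and no other inner
vertex of it is in `Z`. -/
structure IsActiveTrail (G : DAG V) (Z : Set V) (x y : V) (l : List V) : Prop where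
  head : l.head? = some x
  last : l.getLast? = some y
  chain : l.IsChain G.Adj
  collider : ∀ a b c, [a, b, c] <:+: l → G.Collider a b c →
    ∃ d ∈ Z, Relation.ReflTransGen G.arc b d
  noncollider : ∀ a b c, [a, b, c] <:+: l → ¬ G.Collider a b c → b ∉ Z

/-- `X` and `Y` are d-separated by `Z`: no trail between them is active given `Z`. -/
def DSep (G : DAG V) (X Y Z : Set V) : Prop :=
  ∀ x ∈ X, ∀ y ∈ Y, ∀ l, ¬ G.IsActiveTrail Z x y l

/-- Markov equivalence: both graphs encode the same conditional independences, i.e. they have the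
same d-separations between pairwise disjoint sets of vertices. -/
def MarkovEquiv (G G' : DAG V) : Prop :=
  ∀ X Y Z : Set V, Disjoint X Y → Disjoint X Z → Disjoint Y Z →
    (G.DSep X Y Z ↔ G'.DSep X Y Z)

/-- `𝓘`-Markov equivalence: the graphs are Markov equivalent (the observational data are always
available), and so are their interventional graphs, for each intervention in `𝓘`. -/
def IMarkovEquiv (𝓘 : Set (Set V)) (G G' : DAG V) : Prop :=
  MarkovEquiv G G' ∧ ∀ S ∈ 𝓘, MarkovEquiv (G.intervene S) (G'.intervene S)

/-- The `𝓘`-essential graph, which represents the `𝓘`-Markov equivalence class of `G`: an arc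
`u → v` if all members of the class have the arc `u → v`, and an undirected edge between `u` and
`v` if some member has `u → v` and some member has `v → u`. -/
def essentialGraph (𝓘 : Set (Set V)) (G : DAG V) : PDGraph V where
  und :=
    { Adj := fun u v => (∃ G', IMarkovEquiv 𝓘 G G' ∧ G'.arc u v) ∧
        (∃ G', IMarkovEquiv 𝓘 G G' ∧ G'.arc v u)
      symm := ⟨fun _ _ h => ⟨h.2, h.1⟩⟩
      loopless := ⟨fun v h => by
        obtain ⟨⟨G', -, h'⟩, -⟩ := h
        exact G'.acyclic v (Relation.TransGen.single h')⟩ }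
  arc u v := ∀ G', IMarkovEquiv 𝓘 G G' → G'.arc u v
  arc_asymm u v h h' := by
    have hG : IMarkovEquiv 𝓘 G G :=
      ⟨fun _ _ _ _ _ _ => Iff.rfl, fun _ _ _ _ _ _ _ _ => Iff.rfl⟩
    exact G.acyclic u (Relation.TransGen.tail (Relation.TransGen.single (h G hG)) (h' G hG))
  arc_not_und u v h h' := by
    obtain ⟨-, ⟨G', hG', hvu⟩⟩ := h'
    exact G'.acyclic u (Relation.TransGen.tail (Relation.TransGen.single (h G' hG')) hvu)

end DAG

/-!
The induced essential graph on a chain component is determined by the set of DAGs `G'[H]`, for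
`G'` in the class of `G`. So it suffices to show that restriction to `H` maps the class
of `G` for `𝓘 ∪ 𝓘'` onto the class of `G[H]` for the traces of the members of `𝓘'`
(`essentialGraph_induce_eq`).

Both classes are described by patterns. Two DAGs are Markov equivalent if and only if they have the
same skeleton and the same unshielded colliders (`markovEquiv_iff_patternEq`), and for interventions
the edges with exactly one end in some `S ∈ 𝓘` must also be oriented alike (`iMarkovEquiv_iff`).
That the pattern determines the d-separations is proved by Chickering's argument: two graphs with
the same pattern are joined by a sequence of reversals of covered arcs
(`PatternEq.exists_covered`), and such a reversal does not affect d-connection (`Conn.flip`).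
In this form it is clear that restriction maps into the class of `G[H]` (`IPatternEq.induce`).

For surjectivity, `D` on `H` is put in place of `G[H]`. This is acyclic and has the pattern of `G`
as soon as all vertices of `H` have the same parents outside `H` (`Reorients`). To see this,
let `Forced` be the closure under Meek's rules of the orientations given by unshielded colliders and
cut edges. A forced arc `a → b` and an unforced edge `b - c` give a forced arc `a → c`
(`Forced.trans_unforced`), so the components of the graph of unforced edges have the
required property.

It remains to identify the unforced edges with the undirected edges of the essential graph
(`essentialGraph_und`). Forced arcs lie in all members of the class. Conversely, the unforced graph
is chordal: every vertex set has a simplicial vertex, namely its last one in the order of `G`. Hence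
there is a perfect elimination ordering ending in any given vertex `u`
(`SimpleGraph.exists_ranking`), and orienting the unforced edges against it gives a member of the
class in which they all point away from `u` (`exists_iPatternEq_arc`).
-/

namespace DAG

variable {V : Type*}

/-! ### d-connection as reachability -/

theorem arc_asymm (G : DAG V) {u v : V} (h : G.arc u v) : ¬ G.arc v u := fun h' =>
  G.acyclic u (Relation.TransGen.tail (Relation.TransGen.single h) h')

theorem arc_irrefl (G : DAG V) (u : V) : ¬ G.arc u u := fun h =>
  G.acyclic u (Relation.TransGen.single h)

theorem Adj.symm {G : DAG V} {u v : V} (h : G.Adj u v) : G.Adj v u := Or.symm h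

theorem Adj.ne {G : DAG V} {u v : V} (h : G.Adj u v) : u ≠ v := by
  rintro rfl
  exact h.elim (G.arc_irrefl _) (G.arc_irrefl _)

/-- Reachability of `t` along walks on which an inner vertex is a collider exactly when it lies
in `Z`. `G.Conn Z t d v` says that such a walk runs from `v` to `t`, and the flag `d` records
whether its first edge points into `v`; the walk of length zero has flag `false`. A collider
that merely has a descendant in `Z` is covered by walking down to that descendant and back. -/
inductive Conn (G : DAG V) (Z : Set V) (t : V) : Bool → V → Prop
  | refl : Conn G Z t false t
  | fwd {d : Bool} {v w : V} : Conn G Z t d v → v ∉ Z → G.arc v w → Conn G Z t true w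
  | bwd {v w : V} : Conn G Z t false v → v ∉ Z → G.arc w v → Conn G Z t false w
  | coll {v w : V} : Conn G Z t true v → v ∈ Z → G.arc w v → Conn G Z t false w

theorem Conn.of_collider {G : DAG V} {Z : Set V} {t b d : V} (hd : d ∈ Z)
    (hbd : Relation.ReflTransGen G.arc b d) :
    G.Conn Z t true b → ∀ {c}, G.arc c b → G.Conn Z t false c := by
  induction hbd using Relation.ReflTransGen.head_induction_on with
  | refl => exact fun hb c hc => hb.coll hd hc
  | @head b b' hbb' _ ih =>
    intro hb c hc
    by_cases hbZ : b ∈ Z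
    · exact hb.coll hbZ hc
    · exact (ih (hb.fwd hbZ hbb') hbb').bwd hbZ hc

theorem IsActiveTrail.tail {G : DAG V} {Z : Set V} {x c t : V} {l : List V}
    (h : G.IsActiveTrail Z x t (x :: c :: l)) : G.IsActiveTrail Z c t (c :: l) where
  head := rfl
  last := by simpa using h.last
  chain := by
    have := h.chain
    rw [List.isChain_cons_cons] at this
    exact this.2
  collider a b e he := h.collider a b e (List.infix_cons he)
  noncollider a b e he := h.noncollider a b e (List.infix_cons he)

theorem IsActiveTrail.conn_aux {G : DAG V} {Z : Set V} {t : V} (ht : t ∉ Z) (l : List V) :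
    ∀ x, G.IsActiveTrail Z x t (x :: l) → (x = t ∧ l = []) ∨
      ∃ c l', l = c :: l' ∧ (G.arc x c → G.Conn Z t false x) ∧
        (G.arc c x → G.Conn Z t true x) := by
  induction l with
  | nil =>
    intro x h
    have := h.last
    simp only [List.getLast?_singleton, Option.some.injEq] at this
    exact Or.inl ⟨this, rfl⟩
  | cons c l ih =>
    intro x h
    refine Or.inr ⟨c, l, rfl, ?_⟩
    rcases ih c h.tail with ⟨rfl, rfl⟩ | ⟨e, l', rfl, h1, h2⟩
    · exact ⟨fun hxc => Conn.refl.bwd ht hxc, fun hcx => Conn.refl.fwd ht hcx⟩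
    · have hch := h.chain
      simp only [List.isChain_cons_cons] at hch
      have hin : [x, c, e] <:+: x :: c :: e :: l' := ⟨[], l', rfl⟩
      by_cases hcol : G.Collider x c e
      · obtain ⟨d, hd, hcd⟩ := h.collider _ _ _ hin hcol
        exact ⟨fun hxc => (h2 hcol.2).of_collider hd hcd hxc,
          fun hcx => absurd hcx (G.arc_asymm hcol.1)⟩
      · have hc := h.noncollider _ _ _ hin hcol
        rcases hch.2.1 with hce | hec
        · exact ⟨fun hxc => (h1 hce).bwd hc hxc, fun hcx => (h1 hce).fwd hc hcx⟩
        · exact ⟨fun hxc => absurd ⟨hxc, hec⟩ hcol, fun hcx => (h2 hec).fwd hc hcx⟩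

theorem IsActiveTrail.conn {G : DAG V} {Z : Set V} {x t : V} {l : List V} (ht : t ∉ Z)
    (h : G.IsActiveTrail Z x t l) : ∃ d, G.Conn Z t d x := by
  obtain _ | ⟨y, l⟩ := l
  · simpa using h.head
  · obtain rfl : y = x := by simpa using h.head
    rcases h.conn_aux ht with ⟨rfl, -⟩ | ⟨c, l', rfl, h1, h2⟩
    · exact ⟨_, Conn.refl⟩
    · have hch := h.chain
      simp only [List.isChain_cons_cons] at hch
      exact hch.1.elim (fun h => ⟨_, h1 h⟩) (fun h => ⟨_, h2 h⟩)

/-- Prepending a vertex to an active trail; only the new triple has to be checked. -/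
theorem IsActiveTrail.cons {G : DAG V} {Z : Set V} {w v t : V} {l : List V}
    (h : G.IsActiveTrail Z v t (v :: l)) (hwv : G.Adj w v)
    (hl : ∀ e l', l = e :: l' → (G.Collider w v e ∧ v ∈ Z) ∨ (¬ G.Collider w v e ∧ v ∉ Z)) :
    G.IsActiveTrail Z w t (w :: v :: l) where
  head := rfl
  last := by simpa using h.last
  chain := List.isChain_cons_cons.2 ⟨hwv, h.chain⟩
  collider a b c hin hcol := by
    rcases List.infix_cons_iff.1 hin with hp | hi
    · obtain ⟨l', hl'⟩ := hp
      simp only [List.cons_append, List.nil_append, List.cons.injEq] at hl'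
      obtain ⟨rfl, rfl, hl'⟩ := hl'
      rcases hl _ _ hl'.symm with h' | h'
      · exact ⟨_, h'.2, .refl⟩
      · exact absurd hcol h'.1
    · exact h.collider _ _ _ hi hcol
  noncollider a b c hin hcol := by
    rcases List.infix_cons_iff.1 hin with hp | hi
    · obtain ⟨l', hl'⟩ := hp
      simp only [List.cons_append, List.nil_append, List.cons.injEq] at hl'
      obtain ⟨rfl, rfl, hl'⟩ := hl'
      rcases hl _ _ hl'.symm with h' | h'
      · exact absurd h'.1 hcol
      · exact h'.2
    · exact h.noncollider _ _ _ hi hcol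

theorem Conn.exists_trail {G : DAG V} {Z : Set V} {t v : V} {d : Bool} (h : G.Conn Z t d v) :
    ∃ l, G.IsActiveTrail Z v t (v :: l) ∧ (l = [] → d = false) ∧
      ∀ e l', l = e :: l' → if d then G.arc e v else G.arc v e := by
  induction h with
  | refl =>
    refine ⟨[], ⟨rfl, rfl, by simp, ?_, ?_⟩, by simp, by simp⟩ <;>
    · intro a b c hin
      have := hin.length_le
      simp at this
  | @fwd d v w _ hvZ hvw ih =>
    obtain ⟨l, hl, -, -⟩ := ih
    refine ⟨v :: l, hl.cons (Or.inr hvw) fun e l' _ => Or.inr ⟨fun hc => ?_, hvZ⟩, by simp, ?_⟩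
    · exact G.arc_asymm hvw hc.1
    · rintro _ _ ⟨⟩
      simpa using hvw
  | @bwd v w _ hvZ hwv ih =>
    obtain ⟨l, hl, -, h3⟩ := ih
    refine ⟨v :: l, hl.cons (Or.inl hwv) fun e l' he => Or.inr ⟨fun hc => ?_, hvZ⟩, by simp, ?_⟩
    · have := h3 e l' he
      exact G.arc_asymm (by simpa using this) hc.2
    · rintro _ _ ⟨⟩
      simpa using hwv
  | @coll v w _ hvZ hwv ih =>
    obtain ⟨l, hl, h2, h3⟩ := ih
    refine ⟨v :: l, hl.cons (Or.inl hwv) fun e l' he => Or.inl ⟨⟨hwv, ?_⟩, hvZ⟩, by simp, ?_⟩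
    · have := h3 e l' he
      simpa using this
    · rintro _ _ ⟨⟩
      simpa using hwv

theorem dSep_iff_conn {G : DAG V} {X Y Z : Set V} (hYZ : Disjoint Y Z) :
    G.DSep X Y Z ↔ ∀ x ∈ X, ∀ y ∈ Y, ∀ d, ¬ G.Conn Z y d x := by
  constructor
  · intro h x hx y hy d hc
    obtain ⟨l, hl, -⟩ := hc.exists_trail
    exact h x hx y hy _ hl
  · intro h x hx y hy l hl
    obtain ⟨d, hd⟩ := hl.conn (Set.disjoint_left.1 hYZ hy)
    exact h x hx y hy d hd

/-! ### Reorienting part of a graph -/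

/-- The data needed to give the edges underlying the arcs `D` the orientation `D`:
`D` is acyclic and oriented along the skeleton of `G`, and an arc of `G` into an endpoint of one of
these edges, not being one of them itself, is accompanied by such an arc into the other endpoint. -/
structure Reorients (G : DAG V) (D : V → V → Prop) : Prop where
  acyclic : ∀ v, ¬ Relation.TransGen D v v
  adj : ∀ u v, D u v → G.Adj u v
  parents : ∀ a b c, G.arc a b → ¬ D a b → ¬ D b a → (D b c ∨ D c b) →
    G.arc a c ∧ ¬ D a c ∧ ¬ D c a

/-- Every walk along kept arcs and `D`-arcs is, up to its endpoints, a `D`-walk followed by kept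
arcs of `G`, since a `D`-arc is absorbed by a kept arc before it. -/
theorem Reorients.transGen {G : DAG V} {D : V → V → Prop} (h : G.Reorients D) {x y : V}
    (hxy : Relation.TransGen (fun u v => D u v ∨ (G.arc u v ∧ ¬ D u v ∧ ¬ D v u)) x y) :
    Relation.TransGen D x y ∨ ∃ z w, Relation.ReflTransGen D x z ∧
      Relation.ReflTransGen G.arc z w ∧ (G.arc w y ∧ ¬ D w y ∧ ¬ D y w) := by
  induction hxy with
  | single h1 =>
    rcases h1 with h1 | h1
    · exact Or.inl (.single h1)
    · exact Or.inr ⟨_, _, .refl, .refl, h1⟩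
  | tail _ h1 ih =>
    rcases ih with ih | ⟨z, w, hxz, hzw, hwy⟩
    · rcases h1 with h1 | h1
      · exact Or.inl (ih.tail h1)
      · exact Or.inr ⟨_, _, ih.to_reflTransGen, .refl, h1⟩
    · rcases h1 with h1 | h1
      · exact Or.inr ⟨z, w, hxz, hzw, h.parents _ _ _ hwy.1 hwy.2.1 hwy.2.2 (Or.inl h1)⟩
      · exact Or.inr ⟨z, _, hxz, hzw.tail hwy.1, h1⟩

theorem Reorients.acyclic_union {G : DAG V} {D : V → V → Prop} (h : G.Reorients D) (v : V) :
    ¬ Relation.TransGen (fun u v => D u v ∨ (G.arc u v ∧ ¬ D u v ∧ ¬ D v u)) v v := by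
  intro hv
  rcases h.transGen hv with hv | ⟨z, w, hvz, hzw, hwv⟩
  · exact h.acyclic v hv
  · -- the last kept arc points into `v`, hence into every vertex of the `D`-walk, up to `z`
    have : G.arc w z ∧ ¬ D w z ∧ ¬ D z w := by
      clear hzw
      induction hvz with
      | refl => exact hwv
      | tail _ h1 ih => exact h.parents _ _ _ ih.1 ih.2.1 ih.2.2 (Or.inl h1)
    exact G.acyclic z (Relation.TransGen.tail' hzw this.1)

/-- `G` with the edges underlying `D` oriented as in `D`. -/
def reorient (G : DAG V) (D : V → V → Prop) (h : G.Reorients D) : DAG V where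
  arc u v := D u v ∨ (G.arc u v ∧ ¬ D u v ∧ ¬ D v u)
  acyclic := h.acyclic_union

/-- The same skeleton and the same unshielded colliders. -/
structure PatternEq (G G' : DAG V) : Prop where
  adj : ∀ u v, G.Adj u v ↔ G'.Adj u v
  collider : ∀ a b c, a ≠ c → ¬ G.Adj a c → (G.Collider a b c ↔ G'.Collider a b c)

theorem PatternEq.symm {G G' : DAG V} (h : PatternEq G G') : PatternEq G' G where
  adj u v := (h.adj u v).symm
  collider a b c hac hn := (h.collider a b c hac (mt (h.adj a c).1 hn)).symm

theorem PatternEq.trans {G G' G'' : DAG V} (h : PatternEq G G') (h' : PatternEq G' G'') :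
    PatternEq G G'' where
  adj u v := (h.adj u v).trans (h'.adj u v)
  collider a b c hac hn := (h.collider a b c hac hn).trans
    (h'.collider a b c hac (mt (h.adj a c).2 hn))

theorem Reorients.patternEq {G : DAG V} {D : V → V → Prop} (h : G.Reorients D)
    (hcol : ∀ a b c, a ≠ c → ¬ G.Adj a c → (D a b ∨ D b a) → (D c b ∨ D b c) →
      (G.Collider a b c ↔ D a b ∧ D c b)) :
    PatternEq G (G.reorient D h) where
  adj u v := by
    constructor
    · rintro (h1 | h1)
      · by_cases h2 : D u v ∨ D v u
        · exact h2.imp Or.inl Or.inl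
        · exact Or.inl (Or.inr ⟨h1, not_or.1 h2⟩)
      · by_cases h2 : D v u ∨ D u v
        · exact (h2.imp Or.inl Or.inl).symm
        · exact Or.inr (Or.inr ⟨h1, not_or.1 h2⟩)
    · rintro ((h1 | h1) | (h1 | h1))
      · exact h.adj _ _ h1
      · exact Or.inl h1.1
      · exact (h.adj _ _ h1).symm
      · exact Or.inr h1.1
  collider a b c hac hn := by
    by_cases hU : D a b ∨ D b a <;> by_cases hU' : D c b ∨ D b c
    · rw [hcol a b c hac hn hU hU']
      exact ⟨fun h => ⟨Or.inl h.1, Or.inl h.2⟩, fun h => ⟨h.1.resolve_right fun h' => hU.elim h'.2.1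
        h'.2.2, h.2.resolve_right fun h' => hU'.elim h'.2.1 h'.2.2⟩⟩
    -- a kept arc into `b` would come with an arc joining `a` and `c`
    · refine iff_of_false (fun hc => ?_) (fun hc => ?_)
      · exact hn (Or.inr (h.parents c b a hc.2 (not_or.1 hU').1 (not_or.1 hU').2 hU.symm).1)
      · have h1 := hc.2.resolve_left (not_or.1 hU').1
        exact hn (Or.inr (h.parents c b a h1.1 h1.2.1 h1.2.2 hU.symm).1)
    · refine iff_of_false (fun hc => ?_) (fun hc => ?_)
      · exact hn (Or.inl (h.parents a b c hc.1 (not_or.1 hU).1 (not_or.1 hU).2 hU'.symm).1)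
      · have h1 := hc.1.resolve_left (not_or.1 hU).1
        exact hn (Or.inl (h.parents a b c h1.1 h1.2.1 h1.2.2 hU'.symm).1)
    · rw [not_or] at hU hU'
      exact and_congr ⟨fun h => Or.inr ⟨h, hU⟩, fun h => (h.resolve_left hU.1).1⟩
        ⟨fun h => Or.inr ⟨h, hU'⟩, fun h => (h.resolve_left hU'.1).1⟩

/-! ### Covered arcs and Markov equivalence -/

/-- `x → y` is an arc, and `y` has the same parents as `x` apart from `x` itself. -/
def Covered (G : DAG V) (x y : V) : Prop :=
  G.arc x y ∧ ∀ w, w ≠ x → (G.arc w x ↔ G.arc w y)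

theorem Covered.reorients {G : DAG V} {x y : V} (h : G.Covered x y) :
    G.Reorients (fun u v => u = y ∧ v = x) where
  acyclic v hv := by
    have hne : y ≠ x := by rintro rfl; exact G.arc_irrefl _ h.1
    obtain ⟨hy, -⟩ := (Relation.TransGen.head'_iff.1 hv).choose_spec.1
    obtain ⟨-, hx⟩ := (Relation.TransGen.tail'_iff.1 hv).choose_spec.2
    exact hne (hy.symm.trans hx)
  adj := by
    rintro u v ⟨rfl, rfl⟩
    exact Or.inr h.1
  parents := by
    intro a b c hab h1 h2 h3
    have h4 := h.2 a
    have h5 := G.arc_irrefl a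
    have h6 := G.arc_asymm h.1
    have h7 := h.1
    grind

/-- Reversal of a covered arc. -/
def flip (G : DAG V) (x y : V) (h : G.Covered x y) : DAG V := G.reorient _ h.reorients

theorem Covered.ne {G : DAG V} {x y : V} (h : G.Covered x y) : x ≠ y := by
  rintro rfl; exact G.arc_irrefl _ h.1

theorem flip_arc {G : DAG V} {x y : V} (h : G.Covered x y) (u v : V) :
    (G.flip x y h).arc u v ↔ (u = y ∧ v = x) ∨ (G.arc u v ∧ ¬ (u = x ∧ v = y)) := by
  have : ¬ G.arc y x := G.arc_asymm h.1
  simp only [flip, reorient]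
  constructor
  · rintro (h | ⟨h1, h2, h3⟩)
    · exact Or.inl h
    · exact Or.inr ⟨h1, fun h => h3 h.symm⟩
  · rintro (h | ⟨h1, h2⟩)
    · exact Or.inl h
    · refine Or.inr ⟨h1, ?_, fun h => h2 h.symm⟩
      rintro ⟨rfl, rfl⟩
      exact this h1

theorem patternEq_flip {G : DAG V} {x y : V} (h : G.Covered x y) : PatternEq G (G.flip x y h) := by
  refine Reorients.patternEq h.reorients ?_
  have := h.ne
  rintro a b c hac - h1 h2
  grind

/-- What a state of a walk in `G` becomes after reversal of the covered arc `x → y`. A state away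
from `x` and `y` persists. A state at `x` or `y` is replaced by states of `G'` from which the walk
can be continued in the same ways.

* If neither vertex is in `Z`, the walk leaves `{x, y}` through a child of either vertex or, unless
  it came from a common parent, through a common parent. The state at `y` with flag `false` allows
  all of this in `G'`, and after a common parent both vertices have states with flag `true`.
* If `x ∈ Z`, the walk does not use the arc `x → y`, which would make `x` a noncollider.
* If only `y` is in `Z`, the walk may pass from a common parent through the collider `y` to `x`;
  in `G'` it continues instead from `x`, or from the collider `y`, directly.

States with flag `false` at a vertex of `Z` are dead ends. -/
theorem Conn.flip {G G' : DAG V} {x y t : V} {Z : Set V} (hxy : G.Covered x y)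
    (hG' : ∀ u v, G'.arc u v ↔ (u = y ∧ v = x) ∨ (G.arc u v ∧ ¬ (u = x ∧ v = y)))
    {d : Bool} {v : V} (h : G.Conn Z t d v) (ht : t ∉ Z) :
    (v ≠ x → v ≠ y → G'.Conn Z t d v) ∧
    (x ∉ Z → y ∉ Z → v = x ∨ v = y → G'.Conn Z t false y ∨
      (d = true ∧ G'.Conn Z t true x ∧ G'.Conn Z t true y)) ∧
    (x ∈ Z → v = x ∨ v = y → (d = false ∧ v ∈ Z) ∨ G'.Conn Z t d v) ∧
    (x ∉ Z → y ∈ Z → v = x ∨ v = y → (v = y ∧ d = false) ∨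
      G'.Conn Z t false x ∨ (G'.Conn Z t true x ∧ G'.Conn Z t true y)) := by
  have hne := hxy.ne
  have hnot := G.arc_asymm hxy.1
  have hyx : G'.arc y x := (hG' y x).2 (Or.inl ⟨rfl, rfl⟩)
  have hP : ∀ p, p ≠ x → (G.arc p x ↔ G.arc p y) := hxy.2
  have hk : ∀ u v, G.arc u v → ¬ (u = x ∧ v = y) → G'.arc u v := fun u v h h' =>
    (hG' u v).2 (Or.inr ⟨h, h'⟩)
  have hirr := G.arc_irrefl
  have e1 := @Conn.fwd V G' Z t
  have e2 := @Conn.bwd V G' Z t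
  have e3 := @Conn.coll V G' Z t
  clear hxy hG'
  induction h with
  | refl =>
    have e0 := @Conn.refl V G' Z t
    grind
  | @fwd d v w _ hvZ hvw ih =>
    have hk' := hk v w hvw
    by_cases hx : x ∈ Z <;> by_cases hy : y ∈ Z <;> by_cases hvx : v = x <;>
      by_cases hvy : v = y <;> by_cases hwx : w = x <;> by_cases hwy : w = y <;>
      simp only [hx, hy, hvx, hvy, hwx, hwy] at ih ⊢ <;> grind
  | @bwd v w _ hvZ hwv ih =>
    have hk' := hk w v hwv
    by_cases hx : x ∈ Z <;> by_cases hy : y ∈ Z <;> by_cases hvx : v = x <;>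
      by_cases hvy : v = y <;> by_cases hwx : w = x <;> by_cases hwy : w = y <;>
      simp only [hx, hy, hvx, hvy, hwx, hwy] at ih ⊢ <;> grind
  | @coll v w _ hvZ hwv ih =>
    have hk' := hk w v hwv
    by_cases hx : x ∈ Z <;> by_cases hy : y ∈ Z <;> by_cases hvx : v = x <;>
      by_cases hvy : v = y <;> by_cases hwx : w = x <;> by_cases hwy : w = y <;>
      simp only [hx, hy, hvx, hvy, hwx, hwy] at ih ⊢ <;> grind

theorem Covered.symm_of {G G' : DAG V} {x y : V} (h : G.Covered x y)
    (hG' : ∀ u v, G'.arc u v ↔ (u = y ∧ v = x) ∨ (G.arc u v ∧ ¬ (u = x ∧ v = y))) :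
    G'.Covered y x ∧ ∀ u v, G.arc u v ↔ (u = x ∧ v = y) ∨ (G'.arc u v ∧ ¬ (u = y ∧ v = x)) := by
  have h1 := h.ne
  have h2 := G.arc_asymm h.1
  obtain ⟨h3, h4⟩ := h
  refine ⟨⟨(hG' _ _).2 (Or.inl ⟨rfl, rfl⟩), fun w hw => ?_⟩, fun u v => ?_⟩
  · have := G.arc_irrefl x
    have h6 := h4 w
    rw [hG', hG']
    grind
  · rw [hG']
    grind

theorem Conn.exists_flip {G G' : DAG V} {x y t s d} {Z : Set V} (hxy : G.Covered x y)
    (hG' : ∀ u v, G'.arc u v ↔ (u = y ∧ v = x) ∨ (G.arc u v ∧ ¬ (u = x ∧ v = y)))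
    (ht : t ∉ Z) (hs : s ∉ Z) (h : G.Conn Z t d s) : ∃ d, G'.Conn Z t d s := by
  obtain ⟨h1, h2, h3, h4⟩ := h.flip hxy hG' ht
  have hyx : G'.arc y x := (hG' y x).2 (Or.inl ⟨rfl, rfl⟩)
  have e1 := @Conn.fwd V G' Z t false y x
  by_contra! hn
  have hn1 := hn true
  have hn2 := hn false
  have hn3 := hn d
  by_cases hsx : s = x
  · subst hsx
    by_cases hy : y ∈ Z <;> grind
  · by_cases hsy : s = y
    · subst hsy
      by_cases hx : x ∈ Z <;> grind
    · exact hn3 (h1 hsx hsy)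

theorem markovEquiv_flip {G : DAG V} {x y : V} (h : G.Covered x y) :
    MarkovEquiv G (G.flip x y h) := by
  intro X Y Z _ hXZ hYZ
  rw [dSep_iff_conn hYZ, dSep_iff_conn hYZ]
  obtain ⟨h', h''⟩ := h.symm_of (flip_arc h)
  constructor
  · intro H s hs t ht d hd
    obtain ⟨d', hd'⟩ := hd.exists_flip h' h'' (Set.disjoint_left.1 hYZ ht)
      (Set.disjoint_left.1 hXZ hs)
    exact H s hs t ht d' hd'
  · intro H s hs t ht d hd
    obtain ⟨d', hd'⟩ := hd.exists_flip h (flip_arc h) (Set.disjoint_left.1 hYZ ht)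
      (Set.disjoint_left.1 hXZ hs)
    exact H s hs t ht d' hd'

theorem wellFounded_transGen [Finite V] (G : DAG V) : WellFounded (Relation.TransGen G.arc) :=
  haveI : IsTrans V (Relation.TransGen G.arc) := ⟨fun _ _ _ => Relation.TransGen.trans⟩
  haveI : Std.Irrefl (Relation.TransGen G.arc) := ⟨G.acyclic⟩
  Finite.wellFounded_of_trans_of_irrefl _

theorem wellFounded_transGen_swap [Finite V] (G : DAG V) :
    WellFounded (fun u v => Relation.TransGen G.arc v u) :=
  haveI : IsTrans V (fun u v => Relation.TransGen G.arc v u) := ⟨fun _ _ _ h h' => h'.trans h⟩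
  haveI : Std.Irrefl (fun u v => Relation.TransGen G.arc v u) := ⟨G.acyclic⟩
  Finite.wellFounded_of_trans_of_irrefl _

/-- Two distinct DAGs with the same pattern disagree on an arc that is covered in the first. Its
head is an earliest head of a disagreeing arc, and its tail is then chosen as late as possible. -/
theorem PatternEq.exists_covered [Finite V] {G G' : DAG V} (h : PatternEq G G')
    (hne : ∃ u v, G.arc u v ∧ ¬ G'.arc u v) : ∃ x y, G.Covered x y ∧ ¬ G'.arc x y := by
  have rev : ∀ {u v}, G.arc u v → ¬ G'.arc u v → G'.arc v u := fun {u v} h1 h2 =>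
    ((h.adj u v).1 (Or.inl h1)).resolve_left h2
  obtain ⟨u₀, v₀, h₀⟩ := hne
  obtain ⟨y, ⟨u, hu⟩, hymin⟩ := G.wellFounded_transGen.has_min
    {y | ∃ u, G.arc u y ∧ ¬ G'.arc u y} ⟨v₀, u₀, h₀⟩
  obtain ⟨x, hx, hxmax⟩ := G.wellFounded_transGen_swap.has_min
    {x | G.arc x y ∧ ¬ G'.arc x y} ⟨u, hu⟩
  have hyx := rev hx.1 hx.2
  -- arcs of `G` into a parent of `y` are arcs of `G'` too, by the choice of `y`
  have early : ∀ a b, G.arc a b → G.arc b y → G'.arc a b := by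
    intro a b hab hby
    by_contra hn
    exact hymin b ⟨a, hab, hn⟩ (.single hby)
  refine ⟨x, y, ⟨hx.1, fun w hwx => ⟨fun hw => ?_, fun hw => ?_⟩⟩, hx.2⟩
  · have hwy : w ≠ y := by
      rintro rfl
      exact G.arc_asymm hw hx.1
    have hw' := early w x hw hx.1
    by_cases had : G.Adj w y
    · refine had.resolve_right fun hyw => ?_
      exact G.acyclic w (((Relation.TransGen.single hw).tail hx.1).tail hyw)
    · exact absurd ((h.collider w x y hwy had).2 ⟨hw', hyx⟩).2 (G.arc_asymm hx.1)
  · by_cases had : G.Adj w x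
    · refine had.resolve_right fun hxw => ?_
      have hxw' := early x w hxw hw
      by_cases hw' : G'.arc w y
      · exact G'.acyclic x (((Relation.TransGen.single hxw').tail hw').tail hyx)
      · exact hxmax w ⟨hw, hw'⟩ (.single hxw)
    · exact absurd ((h.collider w y x hwx had).1 ⟨hw, hx.1⟩).2 hx.2

theorem MarkovEquiv.trans {G G' G'' : DAG V} (h : MarkovEquiv G G') (h' : MarkovEquiv G' G'') :
    MarkovEquiv G G'' := fun X Y Z h1 h2 h3 => (h X Y Z h1 h2 h3).trans (h' X Y Z h1 h2 h3)

/-- Reversing a covered arc on which the graphs disagree removes one disagreement and creates none. -/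
theorem PatternEq.markovEquiv [Finite V] {G G' : DAG V} (h : PatternEq G G') :
    MarkovEquiv G G' := by
  induction hn : {p : V × V | G.arc p.1 p.2 ∧ ¬ G'.arc p.1 p.2}.ncard using
    Nat.strong_induction_on generalizing G with
  | _ n ih =>
    by_cases hne : ∃ u v, G.arc u v ∧ ¬ G'.arc u v
    · obtain ⟨x, y, hxy, hxy'⟩ := h.exists_covered hne
      refine (markovEquiv_flip hxy).trans (ih _ ?_ ((patternEq_flip hxy).symm.trans h) rfl)
      rw [← hn]
      refine Set.ncard_lt_ncard ?_ (Set.toFinite _)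
      rw [Set.ssubset_iff_of_subset]
      · refine ⟨(x, y), ⟨hxy.1, hxy'⟩, fun hc => ?_⟩
        have := (flip_arc hxy x y).1 hc.1
        have := hxy.ne
        grind
      · rintro ⟨u, v⟩ ⟨h1, h2⟩
        rcases (flip_arc hxy u v).1 h1 with ⟨rfl, rfl⟩ | h3
        · exact absurd (((h.adj v u).1 (Or.inl hxy.1)).resolve_left hxy') h2
        · exact ⟨h3.1, h2⟩
    · push Not at hne
      have : G = G' := by
        ext u v
        refine ⟨hne u v, fun huv => ?_⟩
        refine ((h.adj u v).2 (Or.inl huv)).resolve_right fun hvu => ?_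
        exact G'.arc_asymm huv (hne _ _ hvu)
      subst this
      exact fun _ _ _ _ _ _ => Iff.rfl

/-! ### Markov equivalent graphs have the same pattern -/

/-- A vertex is d-separated from a nonadjacent nondescendant by its parents. -/
theorem dSep_parents {G : DAG V} {u v : V} (hne : u ≠ v) (hadj : ¬ G.Adj u v)
    (hdesc : ¬ Relation.TransGen G.arc v u) : G.DSep {u} {v} {w | G.arc w v} := by
  have hv : v ∉ {w | G.arc w v} := G.arc_irrefl v
  have key : ∀ d z, G.Conn {w | G.arc w v} v d z →
      (d = false → z = v ∨ G.arc z v) ∧ (d = true → Relation.TransGen G.arc v z) := by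
    intro d z hz
    induction hz with
    | refl => simp
    | @fwd d z w _ hz hzw ih =>
      refine ⟨by simp, fun _ => ?_⟩
      cases d with
      | false => exact (ih.1 rfl).elim (fun h => .single (h ▸ hzw)) (fun h => absurd h hz)
      | true => exact (ih.2 rfl).tail hzw
    | @bwd z w _ hz hwz ih =>
      exact ⟨fun _ => (ih.1 rfl).elim (fun h => Or.inr (h ▸ hwz)) (fun h => absurd h hz), by simp⟩
    | @coll z w _ hz hwz ih => exact absurd ((ih.2 rfl).tail hz) (G.acyclic v)
  rw [dSep_iff_conn (by simpa using hv)]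
  rintro _ rfl _ rfl d hd
  cases d with
  | false => exact ((key _ _ hd).1 rfl).elim hne (fun h => hadj (Or.inl h))
  | true => exact hdesc ((key _ _ hd).2 rfl)

theorem DSep.symm {G : DAG V} {X Y Z : Set V} (h : G.DSep X Y Z) : G.DSep Y X Z := by
  intro y hy x hx l hl
  refine h x hx y hy l.reverse ⟨?_, ?_, ?_, ?_, ?_⟩
  · simpa using hl.last
  · simpa using hl.head
  · rw [List.isChain_reverse]
    exact hl.chain.imp fun _ _ h => Or.symm h
  · intro a b c hin hcol
    exact hl.collider c b a (by simpa using List.reverse_infix.2 hin) ⟨hcol.2, hcol.1⟩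
  · intro a b c hin hcol
    exact hl.noncollider c b a (by simpa using List.reverse_infix.2 hin)
      (fun h => hcol ⟨h.2, h.1⟩)

theorem exists_dSep {G : DAG V} {u v : V} (hne : u ≠ v) (hadj : ¬ G.Adj u v) :
    ∃ Z : Set V, u ∉ Z ∧ v ∉ Z ∧ G.DSep {u} {v} Z := by
  by_cases h : Relation.TransGen G.arc v u
  · exact ⟨{w | G.arc w u}, G.arc_irrefl u, fun h => hadj (Or.inr h),
      (dSep_parents hne.symm (mt Adj.symm hadj) fun h' => G.acyclic _ (h.trans h')).symm⟩
  · exact ⟨{w | G.arc w v}, fun h => hadj (Or.inl h), G.arc_irrefl v, dSep_parents hne hadj h⟩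

theorem not_dSep_of_adj {G : DAG V} {u v : V} {Z : Set V} (h : G.Adj u v) :
    ¬ G.DSep {u} {v} Z := by
  refine fun hs => hs u rfl v rfl [u, v] ⟨rfl, rfl, by simpa using h, ?_, ?_⟩ <;>
  · intro a b c hin
    have := hin.length_le
    simp at this

theorem not_dSep_triple {G : DAG V} {a b c : V} {Z : Set V} (hab : G.Adj a b) (hbc : G.Adj b c)
    (h : G.Collider a b c ↔ b ∈ Z) : ¬ G.DSep {a} {c} Z := by
  have aux : ∀ a' b' c', [a', b', c'] <:+: [a, b, c] → a' = a ∧ b' = b ∧ c' = c := by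
    intro a' b' c' hin
    simpa using hin.eq_of_length rfl
  refine fun hs => hs a rfl c rfl [a, b, c] ⟨rfl, rfl, by simpa using ⟨hab, hbc⟩, ?_, ?_⟩
  · intro a' b' c' hin hcol
    obtain ⟨rfl, rfl, rfl⟩ := aux _ _ _ hin
    exact ⟨_, h.1 hcol, .refl⟩
  · intro a' b' c' hin hcol
    obtain ⟨rfl, rfl, rfl⟩ := aux _ _ _ hin
    exact fun hb => hcol (h.2 hb)

theorem MarkovEquiv.symm {G G' : DAG V} (h : MarkovEquiv G G') : MarkovEquiv G' G :=
  fun X Y Z h1 h2 h3 => (h X Y Z h1 h2 h3).symm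

theorem MarkovEquiv.adj_of_adj {G G' : DAG V} (h : MarkovEquiv G G') {u v : V}
    (huv : G.Adj u v) : G'.Adj u v := by
  by_contra hn
  obtain ⟨Z, hu, hv, hZ⟩ := exists_dSep huv.ne hn
  exact not_dSep_of_adj huv
    ((h {u} {v} Z (by simpa using huv.ne) (by simpa using hu) (by simpa using hv)).2 hZ)

/-- If `a - b - c` is an unshielded collider in only one of the graphs, then a set separating `a`
and `c` in the other one contains `b` and hence activates the trail `a, b, c` in the first. -/
theorem MarkovEquiv.collider_of_collider {G G' : DAG V} (h : MarkovEquiv G G') {a b c : V}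
    (hac : a ≠ c) (hn : ¬ G.Adj a c) (hcol : G.Collider a b c) : G'.Collider a b c := by
  by_contra hcol'
  have hab : G.Adj a b := Or.inl hcol.1
  have hbc : G.Adj b c := Or.inr hcol.2
  obtain ⟨Z, ha, hc, hZ⟩ := exists_dSep (G := G') hac fun h' => hn (h.symm.adj_of_adj h')
  have hb : b ∈ Z := by
    by_contra hb
    exact not_dSep_triple (h.adj_of_adj hab) (h.adj_of_adj hbc) (iff_of_false hcol' hb) hZ
  exact not_dSep_triple hab hbc (iff_of_true hcol hb)
    ((h {a} {c} Z (by simpa using hac) (by simpa using ha) (by simpa using hc)).2 hZ)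

theorem MarkovEquiv.patternEq {G G' : DAG V} (h : MarkovEquiv G G') : PatternEq G G' where
  adj _ _ := ⟨h.adj_of_adj, h.symm.adj_of_adj⟩
  collider _ _ _ hac hn := ⟨h.collider_of_collider hac hn,
    h.symm.collider_of_collider hac (fun h' => hn (h.symm.adj_of_adj h'))⟩

/-- The graphical characterization of Markov equivalence by Verma and Pearl. -/
theorem markovEquiv_iff_patternEq [Finite V] {G G' : DAG V} :
    MarkovEquiv G G' ↔ PatternEq G G' := ⟨MarkovEquiv.patternEq, PatternEq.markovEquiv⟩

/-! ### Interventional Markov equivalence -/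

/-- The same pattern, and the same orientation of each edge cut by an intervention in `𝓘`. -/
structure IPatternEq (𝓘 : Set (Set V)) (G G' : DAG V) : Prop extends PatternEq G G' where
  cut : ∀ S ∈ 𝓘, ∀ u v, ¬ (u ∈ S ↔ v ∈ S) → (G.arc u v ↔ G'.arc u v)

theorem adj_intervene {G : DAG V} {S : Set V} {u v : V} :
    (G.intervene S).Adj u v ↔ G.arc u v ∧ v ∉ S ∨ G.arc v u ∧ u ∉ S := Iff.rfl

theorem PatternEq.cut_of_intervene {G G' : DAG V} {S : Set V} (h : PatternEq G G')
    (hS : ∀ u v, (G.intervene S).Adj u v ↔ (G'.intervene S).Adj u v) {u v : V}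
    (huv : ¬ (u ∈ S ↔ v ∈ S)) : G.arc u v ↔ G'.arc u v := by
  have h1 := hS u v
  have h2 := h.adj u v
  have h3 : G.arc u v → ¬ G.arc v u := G.arc_asymm
  have h4 : G'.arc u v → ¬ G'.arc v u := G'.arc_asymm
  rw [adj_intervene, adj_intervene] at h1
  simp only [Adj] at h2
  tauto

theorem PatternEq.intervene {G G' : DAG V} {S : Set V} (h : PatternEq G G')
    (hS : ∀ u v, ¬ (u ∈ S ↔ v ∈ S) → (G.arc u v ↔ G'.arc u v)) :
    PatternEq (G.intervene S) (G'.intervene S) := by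
  have hadj : ∀ u v, (G.intervene S).Adj u v ↔ (G'.intervene S).Adj u v := by
    intro u v
    have h1 := h.adj u v
    have h2 := hS u v
    have h3 := hS v u
    rw [adj_intervene, adj_intervene]
    simp only [Adj] at h1
    tauto
  -- an unshielded collider of `G_S` is preserved: its arcs with tails in `S` are cut, and if it is
  -- shielded in `G`, then its two tails are both in `S`, or the shielding arc is cut
  have aux : ∀ G G' : DAG V, PatternEq G G' →
      (∀ u v, ¬ (u ∈ S ↔ v ∈ S) → (G.arc u v ↔ G'.arc u v)) →
      ∀ a b c, a ≠ c → ¬ (G.intervene S).Adj a c → (G.intervene S).Collider a b c →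
        (G'.intervene S).Collider a b c := by
    clear h hS hadj
    intro G G' h hS a b c hac hn hcol
    obtain ⟨⟨hab, hb⟩, ⟨hcb, -⟩⟩ := hcol
    suffices hc : G'.arc a b ∧ G'.arc c b from ⟨⟨hc.1, hb⟩, ⟨hc.2, hb⟩⟩
    have third : ∀ p q, G.arc p b → G.arc q b → G.arc p q → p ∉ S → q ∈ S →
        G'.arc p b := by
      intro p q hpb hqb hpq hp hq
      refine ((h.adj p b).1 (Or.inl hpb)).resolve_right fun hbp => ?_
      have h1 := (hS p q (by tauto)).1 hpq
      have h2 := (hS q b (by tauto)).1 hqb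
      exact G'.acyclic b (((Relation.TransGen.single hbp).tail h1).tail h2)
    rw [adj_intervene] at hn
    by_cases had : G.Adj a c
    · by_cases ha : a ∈ S <;> by_cases hc : c ∈ S
      · exact ⟨(hS a b (by tauto)).1 hab, (hS c b (by tauto)).1 hcb⟩
      · refine ⟨(hS a b (by tauto)).1 hab, third c a hcb hab ?_ hc ha⟩
        exact had.resolve_left fun h => hn (Or.inl ⟨h, hc⟩)
      · refine ⟨third a c hab hcb ?_ ha hc, (hS c b (by tauto)).1 hcb⟩
        exact had.resolve_right fun h => hn (Or.inr ⟨h, ha⟩)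
      · exact absurd (had.imp (⟨·, hc⟩) (⟨·, ha⟩)) hn
    · exact (h.collider a b c hac had).1 ⟨hab, hcb⟩
  exact ⟨hadj, fun a b c hac hn => ⟨aux G G' h hS a b c hac hn,
    aux G' G h.symm (fun u v huv => (hS u v huv).symm) a b c hac (mt (hadj a c).2 hn)⟩⟩

theorem iMarkovEquiv_iff [Finite V] {𝓘 : Set (Set V)} {G G' : DAG V} :
    IMarkovEquiv 𝓘 G G' ↔ IPatternEq 𝓘 G G' := by
  simp only [IMarkovEquiv, markovEquiv_iff_patternEq]
  exact ⟨fun h => ⟨h.1, fun S hS _ _ => h.1.cut_of_intervene (h.2 S hS).adj⟩,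
    fun h => ⟨h.toPatternEq, fun S hS => h.intervene (h.cut S hS)⟩⟩

/-! ### Forced arcs -/

/-- The arcs forced by unshielded colliders, by cuts of interventions and by Meek's orientation
rules. The premise of the last rule that `p → a ← q` is not a collider of `G`
replaces the usual one that `a - p` and `a - q` are not oriented, which would be a negative
occurrence of the predicate being defined. -/
inductive Forced (𝓘 : Set (Set V)) (G : DAG V) : V → V → Prop
  | collider {a b d : V} : G.arc a b → G.arc d b → a ≠ d → ¬ G.Adj a d → Forced 𝓘 G a b
  | cut {a b : V} {S : Set V} : G.arc a b → S ∈ 𝓘 → ¬ (a ∈ S ↔ b ∈ S) → Forced 𝓘 G a b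
  | noCollider {a b d : V} : Forced 𝓘 G d a → G.arc a b → d ≠ b → ¬ G.Adj d b → Forced 𝓘 G a b
  | noCycle {a b d : V} : Forced 𝓘 G a d → Forced 𝓘 G d b → G.Adj a b → Forced 𝓘 G a b
  | kite {a b p q : V} : G.arc p b → G.arc q b → p ≠ q → ¬ G.Adj p q → G.Adj a p → G.Adj a q →
      G.Adj a b → ¬ (G.arc p a ∧ G.arc q a) → Forced 𝓘 G a b

theorem IPatternEq.refl (𝓘 : Set (Set V)) (G : DAG V) : IPatternEq 𝓘 G G :=
  ⟨⟨fun _ _ => Iff.rfl, fun _ _ _ _ _ => Iff.rfl⟩, fun _ _ _ _ _ => Iff.rfl⟩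

theorem Forced.arc_of_iPatternEq {𝓘 : Set (Set V)} {G G' : DAG V} (hG : IPatternEq 𝓘 G G')
    {a b : V} (h : Forced 𝓘 G a b) : G'.arc a b := by
  induction h with
  | collider hab hdb hne hn => exact ((hG.collider _ _ _ hne hn).1 ⟨hab, hdb⟩).1
  | cut hab hS hc => exact (hG.cut _ hS _ _ hc).1 hab
  | @noCollider a b d _ hab hne hn ih =>
    refine ((hG.adj a b).1 (Or.inl hab)).resolve_right fun hba => ?_
    exact G.arc_asymm hab ((hG.collider d a b hne hn).2 ⟨ih, hba⟩).2
  | @noCycle a b d _ _ had ih1 ih2 =>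
    refine ((hG.adj a b).1 had).resolve_right fun hba => ?_
    exact G'.acyclic a (((Relation.TransGen.single ih1).tail ih2).tail hba)
  | @kite a b p q hp hq hne hn hap haq had hc =>
    refine ((hG.adj a b).1 had).resolve_right fun hba => hc ?_
    obtain ⟨hp', hq'⟩ := (hG.collider _ _ _ hne hn).1 ⟨hp, hq⟩
    refine (hG.collider p a q hne hn).2 ⟨?_, ?_⟩
    · refine ((hG.adj a p).1 hap).resolve_left fun h => ?_
      exact G'.acyclic a (((Relation.TransGen.single h).tail hp').tail hba)
    · refine ((hG.adj a q).1 haq).resolve_left fun h => ?_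
      exact G'.acyclic a (((Relation.TransGen.single h).tail hq').tail hba)

theorem Forced.arc {𝓘 : Set (Set V)} {G : DAG V} {a b : V} (h : Forced 𝓘 G a b) : G.arc a b :=
  h.arc_of_iPatternEq (.refl 𝓘 G)

theorem Forced.adj {𝓘 : Set (Set V)} {G : DAG V} {a b : V} (h : Forced 𝓘 G a b) : G.Adj a b :=
  Or.inl h.arc

/-- The graph of the edges that are not forced in either direction. -/
def unforced (𝓘 : Set (Set V)) (G : DAG V) : SimpleGraph V where
  Adj a b := G.Adj a b ∧ ¬ Forced 𝓘 G a b ∧ ¬ Forced 𝓘 G b a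
  symm := ⟨fun _ _ h => ⟨h.1.symm, h.2.2, h.2.1⟩⟩
  loopless := ⟨fun _ h => h.1.ne rfl⟩

theorem forced_of_arc {𝓘 : Set (Set V)} {G : DAG V} {a b : V} (h : G.arc a b)
    (hn : ¬ (G.unforced 𝓘).Adj a b) : Forced 𝓘 G a b := by
  by_contra h'
  exact hn ⟨Or.inl h, h', fun h'' => G.arc_asymm h h''.arc⟩

theorem Forced.adj_of_unforced {𝓘 : Set (Set V)} {G : DAG V} {a b c : V} (h : Forced 𝓘 G a b)
    (hbc : (G.unforced 𝓘).Adj b c) : G.Adj a c := by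
  by_contra hn
  have hne : a ≠ c := by
    rintro rfl
    exact hbc.2.2 h
  rcases hbc.1 with h1 | h1
  · exact hbc.2.1 (.noCollider h h1 hne hn)
  · exact hbc.2.2 (.collider h1 h.arc hne.symm fun h => hn h.symm)

theorem Forced.of_not_unforced {𝓘 : Set (Set V)} {G : DAG V} {a b c : V} (h : Forced 𝓘 G a b)
    (hbc : (G.unforced 𝓘).Adj b c) (hac : ¬ (G.unforced 𝓘).Adj a c) : Forced 𝓘 G a c := by
  have had := h.adj_of_unforced hbc
  by_contra h'
  have hca : Forced 𝓘 G c a := by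
    by_contra h''
    exact hac ⟨had, h', h''⟩
  exact hbc.2.2 (.noCycle hca h hbc.1.symm)

theorem forced_of_collider {𝓘 : Set (Set V)} {G : DAG V} {a b c d : V} (hab : G.arc a b)
    (hdb : G.arc d b) (hne : a ≠ d) (hn : ¬ G.Adj a d) (hbc : (G.unforced 𝓘).Adj b c) :
    Forced 𝓘 G a c := by
  have ha : Forced 𝓘 G a b := .collider hab hdb hne hn
  have hd : Forced 𝓘 G d b := .collider hdb hab hne.symm fun h => hn h.symm
  have hac := ha.adj_of_unforced hbc
  have hdc := hd.adj_of_unforced hbc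
  by_contra h
  refine hbc.2.2 (.kite hab hdb hne hn hac.symm hdc.symm hbc.1.symm fun hc => h ?_)
  exact .collider hc.1 hc.2 hne hn

/-- The key property of Meek's rules: a forced arc into an endpoint of an unforced edge is
accompanied by a forced arc into the other endpoint. -/
theorem Forced.trans_unforced {𝓘 : Set (Set V)} {G : DAG V} {a b c : V} (h : Forced 𝓘 G a b)
    (hbc : (G.unforced 𝓘).Adj b c) : Forced 𝓘 G a c := by
  induction h generalizing c with
  | collider hab hdb hne hn => exact forced_of_collider hab hdb hne hn hbc
  | @cut a b S hab hS hc =>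
    refine (Forced.cut hab hS hc).of_not_unforced hbc fun hac => ?_
    -- an edge cut by an intervention is forced, so both `b, c` and `a, c` are on the same side
    have key : ∀ u v, (G.unforced 𝓘).Adj u v → (u ∈ S ↔ v ∈ S) := by
      intro u v huv
      by_contra hc
      rcases huv.1 with h | h
      · exact huv.2.1 (.cut h hS hc)
      · exact huv.2.2 (.cut h hS (fun h => hc h.symm))
    exact hc ((key _ _ hac).trans (key _ _ hbc).symm)
  | @noCollider a b d hda hab hne hn ih =>
    refine (Forced.noCollider hda hab hne hn).of_not_unforced hbc fun hac => ?_
    have hdc := ih hac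
    exact hn (hdc.adj_of_unforced hbc.symm)
  | @noCycle a b d had hdb hadj _ ih =>
    have hab := Forced.noCycle had hdb hadj
    exact .noCycle had (ih hbc) (hab.adj_of_unforced hbc)
  | @kite a b p q hp hq hne hn hap haq had hc =>
    refine (Forced.kite hp hq hne hn hap haq had hc).of_not_unforced hbc fun hac => ?_
    have hpc := forced_of_collider (𝓘 := 𝓘) hp hq hne hn hbc
    have hqc := forced_of_collider (𝓘 := 𝓘) hq hp hne.symm (fun h => hn h.symm) hbc
    have hn' : ¬ G.Adj q p := fun h => hn h.symm
    exact hc ⟨(forced_of_collider hpc.arc hqc.arc hne hn hac.symm).arc,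
      (forced_of_collider hqc.arc hpc.arc hne.symm hn' hac.symm).arc⟩

theorem Forced.of_reachable {𝓘 : Set (Set V)} {G : DAG V} {a b c : V} (h : Forced 𝓘 G a b)
    (hbc : (G.unforced 𝓘).Reachable b c) : Forced 𝓘 G a c := by
  obtain ⟨w⟩ := hbc
  induction w with
  | nil => exact h
  | cons hadj _ ih => exact ih (h.trans_unforced hadj)

/-- No forced arc joins two vertices of the same component of the unforced graph. -/
theorem unforced_adj_of_reachable {𝓘 : Set (Set V)} {G : DAG V} {a b : V}
    (hab : (G.unforced 𝓘).Reachable a b) (h : G.Adj a b) : (G.unforced 𝓘).Adj a b :=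
  ⟨h, fun h' => G.arc_irrefl a (h'.of_reachable hab.symm).arc,
    fun h' => G.arc_irrefl b (h'.of_reachable hab).arc⟩

end DAG

/-! ### Simplicial vertices -/

namespace SimpleGraph

variable {V : Type*}

/-- The neighbors of `v ∈ A` in `A` are pairwise adjacent. -/
def IsSimplicialIn (U : SimpleGraph V) (A : Finset V) (v : V) : Prop :=
  v ∈ A ∧ ∀ p ∈ A, ∀ q ∈ A, U.Adj v p → U.Adj v q → p ≠ q → U.Adj p q

/-- If every nonempty vertex set has a simplicial vertex, then one can be found outside any given
clique that is not the whole set. -/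
theorem exists_isSimplicialIn_notMem [DecidableEq V] {U : SimpleGraph V}
    (hU : ∀ A : Finset V, A.Nonempty → ∃ v, U.IsSimplicialIn A v) (A K : Finset V)
    (hK : ∀ p ∈ K, ∀ q ∈ K, p ≠ q → U.Adj p q) (hKA : ∃ v ∈ A, v ∉ K) :
    ∃ v, U.IsSimplicialIn A v ∧ v ∉ K := by
  classical
  induction A using Finset.strongInduction generalizing K with
  | H A ih =>
    obtain ⟨w, hwA, hwK⟩ := hKA
    obtain ⟨t, htA, ht⟩ := hU A ⟨w, hwA⟩
    by_cases htK : t ∈ K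
    · by_cases hN : ∃ v ∈ A.erase t, v ∉ A.filter (U.Adj t)
      · obtain ⟨v, ⟨hv, hvs⟩, hvN⟩ := ih (A.erase t) (Finset.erase_ssubset htA) (A.filter (U.Adj t))
          (fun p hp q hq => ht p (Finset.mem_filter.1 hp).1 q (Finset.mem_filter.1 hq).1
            (Finset.mem_filter.1 hp).2 (Finset.mem_filter.1 hq).2) hN
        obtain ⟨hvt, hvA⟩ := Finset.mem_erase.1 hv
        have htv : ¬ U.Adj t v := fun h => hvN (Finset.mem_filter.2 ⟨hvA, h⟩)
        refine ⟨v, ⟨hvA, fun p hp q hq hvp hvq => hvs p ?_ q ?_ hvp hvq⟩,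
          fun hvK => htv (hK t htK v hvK hvt.symm)⟩
        · exact Finset.mem_erase.2 ⟨fun h => htv (h ▸ hvp).symm, hp⟩
        · exact Finset.mem_erase.2 ⟨fun h => htv (h ▸ hvq).symm, hq⟩
      · -- all vertices are neighbors of the simplicial vertex `t`, so `A` is a clique
        push Not at hN
        have htN : ∀ v ∈ A, v ≠ t → U.Adj t v := fun v hv hvt =>
          (Finset.mem_filter.1 (hN v (Finset.mem_erase.2 ⟨hvt, hv⟩))).2
        refine ⟨w, ⟨hwA, fun p hp q hq _ _ hpq => ?_⟩, hwK⟩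
        by_cases hpt : p = t
        · subst hpt
          exact htN q hq hpq.symm
        · by_cases hqt : q = t
          · subst hqt
            exact (htN p hp hpt).symm
          · exact ht p hp q hq (htN p hp hpt) (htN q hq hqt) hpq
    · exact ⟨t, ⟨htA, ht⟩, htK⟩

/-- A ranking of the vertices that starts with `y` and in which the neighbors preceding a vertex
are pairwise adjacent: the reverse of a perfect elimination ordering ending in `y`. -/
theorem exists_ranking [DecidableEq V] {U : SimpleGraph V}
    (hU : ∀ A : Finset V, A.Nonempty → ∃ v, U.IsSimplicialIn A v) {A : Finset V} {y : V}
    (hy : y ∈ A) : ∃ r : V → ℕ, Set.InjOn r A ∧ (∀ v ∈ A, r y ≤ r v) ∧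
      ∀ p ∈ A, ∀ q ∈ A, ∀ s ∈ A, U.Adj p q → U.Adj s q → r p < r q → r s < r q → p ≠ s →
        U.Adj p s := by
  induction A using Finset.strongInduction with
  | H A ih =>
    by_cases hA : ∃ v ∈ A, v ∉ ({y} : Finset V)
    · obtain ⟨v, ⟨hvA, hv⟩, hvy⟩ := U.exists_isSimplicialIn_notMem hU A {y}
        (by simp +contextual) hA
      obtain ⟨r, hinj, hmin, hr⟩ := ih (A.erase v) (Finset.erase_ssubset hvA)
        (Finset.mem_erase.2 ⟨fun h => hvy (by simp [h]), hy⟩)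
      have hvy : y ≠ v := fun h => hvy (by simp [h])
      have hlt : ∀ u ∈ A, u ≠ v → r u < A.sup r + 1 := fun u hu _ =>
        Nat.lt_succ_of_le (Finset.le_sup hu)
      refine ⟨Function.update r v (A.sup r + 1), ?_, ?_, ?_⟩
      · intro u hu w hw huw
        by_cases h1 : u = v <;> by_cases h2 : w = v
        · rw [h1, h2]
        · subst h1
          have := hlt w hw h2
          simp [Function.update_of_ne h2] at huw
          omega
        · subst h2
          have := hlt u hu h1
          simp [Function.update_of_ne h1] at huw
          omega
        · rw [Function.update_of_ne h1, Function.update_of_ne h2] at huw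
          exact hinj (Finset.mem_erase.2 ⟨h1, hu⟩) (Finset.mem_erase.2 ⟨h2, hw⟩) huw
      · intro u hu
        rw [Function.update_of_ne hvy]
        by_cases h1 : u = v
        · subst h1
          simpa using (hlt y hy hvy).le
        · rw [Function.update_of_ne h1]
          exact hmin u (Finset.mem_erase.2 ⟨h1, hu⟩)
      · intro p hp q hq s hs hpq hsq h1 h2 hps
        by_cases hqv : q = v
        · subst hqv
          exact hv p hp s hs hpq.symm hsq.symm hps
        · have hq' := hlt q hq hqv
          rw [Function.update_of_ne hqv] at h1 h2
          have hpv : p ≠ v := by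
            rintro rfl
            simp at h1
            omega
          have hsv : s ≠ v := by
            rintro rfl
            simp at h2
            omega
          rw [Function.update_of_ne hpv] at h1
          rw [Function.update_of_ne hsv] at h2
          exact hr p (Finset.mem_erase.2 ⟨hpv, hp⟩) q (Finset.mem_erase.2 ⟨hqv, hq⟩) s
            (Finset.mem_erase.2 ⟨hsv, hs⟩) hpq hsq h1 h2 hps
    · have hA' : ∀ v ∈ A, v = y := by simpa using hA
      refine ⟨fun _ => 0, fun u hu w hw _ => (hA' u hu).trans (hA' w hw).symm, by simp, by simp⟩

end SimpleGraph

namespace DAG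

variable {V : Type*}

/-! ### The undirected edges of the essential graph -/

/-- A latest vertex of the set in the order given by `G` is simplicial, because its unforced
neighbors in the set are parents that do not form unshielded colliders. -/
theorem exists_isSimplicialIn_unforced [Finite V] (𝓘 : Set (Set V)) (G : DAG V) (A : Finset V)
    (hA : A.Nonempty) : ∃ v, (G.unforced 𝓘).IsSimplicialIn A v := by
  obtain ⟨v, hv, hmax⟩ := G.wellFounded_transGen_swap.has_min (A : Set V) hA
  have hpar : ∀ p ∈ A, (G.unforced 𝓘).Adj v p → G.arc p v := fun p hp hvp =>
    hvp.1.resolve_left fun h => hmax p hp (.single h)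
  refine ⟨v, hv, fun p hp q hq hvp hvq hpq => ?_⟩
  refine unforced_adj_of_reachable (hvp.symm.reachable.trans hvq.reachable) ?_
  by_contra hn
  exact hvp.2.2 (.collider (hpar p hp hvp) (hpar q hq hvq) hpq hn)

/-- Every vertex `u` is a source, with respect to the unforced edges, in some graph of the class. -/
theorem exists_iPatternEq_arc [Finite V] {𝓘 : Set (Set V)} {G : DAG V} (u : V) :
    ∃ G', IPatternEq 𝓘 G G' ∧ ∀ v, (G.unforced 𝓘).Adj u v → G'.arc u v := by
  classical
  have := Fintype.ofFinite V
  obtain ⟨r, hinj, hmin, hr⟩ := SimpleGraph.exists_ranking (exists_isSimplicialIn_unforced 𝓘 G)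
    (Finset.mem_univ u)
  have hinj' : ∀ a b, r a = r b → a = b := fun a b h => hinj (by simp) (by simp) h
  have hlt : ∀ a b, (G.unforced 𝓘).Adj a b → r a < r b ∨ r b < r a := fun a b h =>
    lt_or_gt_of_ne fun h' => h.ne (hinj' a b h')
  have hD : G.Reorients (fun a b => (G.unforced 𝓘).Adj a b ∧ r a < r b) := by
    refine ⟨fun v hv => ?_, fun a b h => h.1.1, fun a b c hab h1 h2 h3 => ?_⟩
    · have : ∀ w, Relation.TransGen (fun a b => (G.unforced 𝓘).Adj a b ∧ r a < r b) v w →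
          r v < r w := by
        intro w hw
        induction hw with
        | single h => exact h.2
        | tail _ h ih => exact ih.trans h.2
      exact (this v hv).false
    · have hn : ¬ (G.unforced 𝓘).Adj a b := fun h => (hlt a b h).elim (fun h' => h1 ⟨h, h'⟩)
        fun h' => h2 ⟨h.symm, h'⟩
      have hbc : (G.unforced 𝓘).Adj b c := h3.elim And.left fun h => h.1.symm
      have hac := (forced_of_arc hab hn).trans_unforced hbc
      exact ⟨hac.arc, fun h => h.1.2.1 hac, fun h => h.1.2.2 hac⟩
  refine ⟨G.reorient _ hD, ⟨hD.patternEq ?_, ?_⟩, fun v huv => Or.inl ⟨huv, ?_⟩⟩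
  · intro a b c hac hn h1 h2
    have hab : (G.unforced 𝓘).Adj a b := h1.elim And.left fun h => h.1.symm
    refine iff_of_false (fun hc => hab.2.1 (.collider hc.1 hc.2 hac hn)) fun hc => hn ?_
    exact (hr a (Finset.mem_univ a) b (Finset.mem_univ b) c (Finset.mem_univ c)
      hc.1.1 hc.2.1 hc.1.2 hc.2.2 hac).1
  · intro S hS a b hc
    have hn : ¬ (G.unforced 𝓘).Adj a b := fun h => h.1.elim (fun h' => h.2.1 (.cut h' hS hc))
      fun h' => h.2.2 (.cut h' hS fun h => hc h.symm)
    exact ⟨fun h => Or.inr ⟨h, fun h => hn h.1, fun h => hn h.1.symm⟩,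
      fun h => (h.resolve_left fun h => hn h.1).1⟩
  · exact (hlt u v huv).resolve_right (hmin v (Finset.mem_univ v)).not_gt

theorem essentialGraph_und [Finite V] (𝓘 : Set (Set V)) (G : DAG V) :
    (G.essentialGraph 𝓘).und = G.unforced 𝓘 := by
  ext u v
  constructor
  · rintro ⟨⟨G₁, h₁, huv⟩, ⟨G₂, h₂, hvu⟩⟩
    rw [iMarkovEquiv_iff] at h₁ h₂
    exact ⟨(h₁.adj u v).2 (Or.inl huv), fun h => G₂.arc_asymm hvu (h.arc_of_iPatternEq h₂),
      fun h => G₁.arc_asymm huv (h.arc_of_iPatternEq h₁)⟩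
  · intro h
    obtain ⟨G₁, h₁, h₁'⟩ := exists_iPatternEq_arc (𝓘 := 𝓘) (G := G) u
    obtain ⟨G₂, h₂, h₂'⟩ := exists_iPatternEq_arc (𝓘 := 𝓘) (G := G) v
    exact ⟨⟨G₁, iMarkovEquiv_iff.2 h₁, h₁' v h⟩, ⟨G₂, iMarkovEquiv_iff.2 h₂, h₂' u h.symm⟩⟩

/-! ### Restriction to a chain component -/

theorem IPatternEq.induce {𝓙 𝓘' : Set (Set V)} {G G' : DAG V} (h : IPatternEq 𝓙 G G')
    (h𝓘 : 𝓘' ⊆ 𝓙) (s : Set V) :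
    IPatternEq {T : Set s | ∃ S ∈ 𝓘', T = {v : s | (v : V) ∈ S}} (G.induce s) (G'.induce s) where
  adj u v := h.adj u v
  collider a b c hac hn := h.collider a b c (fun h => hac (Subtype.ext h)) hn
  cut := by
    rintro _ ⟨S, hS, rfl⟩ u v huv
    exact h.cut S (h𝓘 hS) u v huv

/-- A graph equivalent to `G` on a component of the unforced graph can be put in place of that
part of `G`, because the vertices of the component have the same parents outside. -/
theorem exists_iPatternEq_induce_eq {𝓘 𝓘' : Set (Set V)} {G : DAG V}
    (H : (G.unforced 𝓘).ConnectedComponent) {D : DAG H.supp}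
    (hD : IPatternEq {T : Set H.supp | ∃ S ∈ 𝓘', T = {v : H.supp | (v : V) ∈ S}}
      (G.induce H.supp) D) :
    ∃ G', IPatternEq (𝓘 ∪ 𝓘') G G' ∧ G'.induce H.supp = D := by
  have hadj : ∀ u v (hu : u ∈ H.supp) (hv : v ∈ H.supp),
      D.Adj ⟨u, hu⟩ ⟨v, hv⟩ ↔ G.Adj u v := fun u v hu hv => (hD.adj ⟨u, hu⟩ ⟨v, hv⟩).symm
  have hU : ∀ u v, u ∈ H.supp → v ∈ H.supp → G.Adj u v → (G.unforced 𝓘).Adj u v :=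
    fun u v hu hv h => unforced_adj_of_reachable (H.reachable_of_mem_supp hu hv) h
  let E : V → V → Prop := fun u v => ∃ (hu : u ∈ H.supp) (hv : v ∈ H.supp),
    D.arc ⟨u, hu⟩ ⟨v, hv⟩
  have hE : ∀ u v (hu : u ∈ H.supp) (hv : v ∈ H.supp), E u v ↔ D.arc ⟨u, hu⟩ ⟨v, hv⟩ :=
    fun u v hu hv => ⟨fun h => h.choose_spec.choose_spec, fun h => ⟨hu, hv, h⟩⟩
  have hEG : G.Reorients E := by
    refine ⟨fun v hv => ?_, ?_, fun a b c hab h1 h2 h3 => ?_⟩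
    · have : ∀ w, Relation.TransGen E v w → ∃ (hv : v ∈ H.supp) (hw : w ∈ H.supp),
          Relation.TransGen D.arc ⟨v, hv⟩ ⟨w, hw⟩ := by
        intro w hw
        induction hw with
        | single h =>
          obtain ⟨h1, h2, h3⟩ := h
          exact ⟨h1, h2, .single h3⟩
        | tail _ h ih =>
          obtain ⟨h1, h2, h3⟩ := h
          obtain ⟨h4, h5, h6⟩ := ih
          exact ⟨h4, h2, h6.tail h3⟩
      obtain ⟨h1, h2, h3⟩ := this v hv
      exact D.acyclic _ h3
    · rintro u v ⟨hu, hv, h⟩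
      exact (hadj u v hu hv).1 (Or.inl h)
    · have hbc : b ∈ H.supp ∧ c ∈ H.supp ∧ G.Adj b c := by
        rcases h3 with ⟨h4, h5, h6⟩ | ⟨h4, h5, h6⟩
        · exact ⟨h4, h5, (hadj _ _ h4 h5).1 (Or.inl h6)⟩
        · exact ⟨h5, h4, (hadj _ _ h5 h4).1 (Or.inr h6)⟩
      obtain ⟨hb, hc, hbc⟩ := hbc
      have ha : a ∉ H.supp := fun ha => ((hadj a b ha hb).2 (Or.inl hab)).elim
        (fun h => h1 ⟨ha, hb, h⟩) fun h => h2 ⟨hb, ha, h⟩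
      have hnab : ¬ (G.unforced 𝓘).Adj a b := fun h =>
        ha (H.mem_supp_of_adj_mem_supp hb h.symm)
      have hac := (forced_of_arc hab hnab).trans_unforced (hU b c hb hc hbc)
      exact ⟨hac.arc, fun h => ha h.choose, fun h => ha h.choose_spec.choose⟩
  have hin : ∀ u v (hu : u ∈ H.supp) (hv : v ∈ H.supp),
      (G.reorient E hEG).arc u v ↔ D.arc ⟨u, hu⟩ ⟨v, hv⟩ := by
    intro u v hu hv
    refine ⟨fun h => h.elim (hE u v hu hv).1 fun h => ?_, fun h => Or.inl ⟨hu, hv, h⟩⟩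
    exact ((hadj u v hu hv).2 (Or.inl h.1)).elim id
      fun h' => absurd ⟨hv, hu, h'⟩ h.2.2
  refine ⟨G.reorient E hEG, ⟨hEG.patternEq ?_, ?_⟩, ?_⟩
  · intro a b c hac hn h1 h2
    have hab : a ∈ H.supp ∧ b ∈ H.supp := h1.elim (fun h => ⟨h.choose, h.choose_spec.choose⟩)
      fun h => ⟨h.choose_spec.choose, h.choose⟩
    have hc : c ∈ H.supp := h2.elim (fun h => h.choose) fun h => h.choose_spec.choose
    rw [hE a b hab.1 hab.2, hE c b hc hab.2]
    exact hD.collider ⟨a, hab.1⟩ ⟨b, hab.2⟩ ⟨c, hc⟩ (fun h => hac (congrArg Subtype.val h)) hn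
  · intro S hS u v huv
    by_cases hH : u ∈ H.supp ∧ v ∈ H.supp
    · rw [hin u v hH.1 hH.2]
      rcases hS with hS | hS
      · -- the edges inside the component are unforced, so they are not cut by `S ∈ 𝓘`
        have hn : ¬ G.Adj u v := by
          intro h
          obtain ⟨h, h1, h2⟩ := hU u v hH.1 hH.2 h
          exact h.elim (fun h => h1 (.cut h hS huv))
            fun h => h2 (.cut h hS fun h => huv h.symm)
        exact iff_of_false (fun h => hn (Or.inl h))
          fun h => hn ((hadj u v hH.1 hH.2).1 (Or.inl h))
      · exact hD.cut _ ⟨S, hS, rfl⟩ ⟨u, hH.1⟩ ⟨v, hH.2⟩ huv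
    · have h1 : ¬ E u v := fun h => hH ⟨h.choose, h.choose_spec.choose⟩
      have h2 : ¬ E v u := fun h => hH ⟨h.choose_spec.choose, h.choose⟩
      exact ⟨fun h => Or.inr ⟨h, h1, h2⟩, fun h => (h.resolve_left h1).1⟩
  · ext u v
    exact hin u v u.2 v.2

/-- If restriction to `s` maps the class of `G` onto the class of `G.induce s`, then the
restriction of the essential graph is the essential graph of the restriction. -/
theorem essentialGraph_induce_eq {𝓙 : Set (Set V)} {G : DAG V} {s : Set V}
    {𝓣 : Set (Set s)} (h₁ : ∀ G', IMarkovEquiv 𝓙 G G' → IMarkovEquiv 𝓣 (G.induce s) (G'.induce s))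
    (h₂ : ∀ D, IMarkovEquiv 𝓣 (G.induce s) D → ∃ G', IMarkovEquiv 𝓙 G G' ∧ G'.induce s = D) :
    (G.essentialGraph 𝓙).induce s = (G.induce s).essentialGraph 𝓣 := by
  have hex : ∀ u v : s, (∃ G', IMarkovEquiv 𝓙 G G' ∧ G'.arc u v) ↔
      ∃ D, IMarkovEquiv 𝓣 (G.induce s) D ∧ D.arc u v := by
    intro u v
    constructor
    · rintro ⟨G', hG', huv⟩
      exact ⟨_, h₁ G' hG', huv⟩
    · rintro ⟨D, hD, huv⟩
      obtain ⟨G', hG', rfl⟩ := h₂ D hD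
      exact ⟨G', hG', huv⟩
  ext u v
  · exact and_congr (hex u v) (hex v u)
  · constructor
    · intro h D hD
      obtain ⟨G', hG', rfl⟩ := h₂ D hD
      exact h G' hG'
    · exact fun h G' hG' => h _ (h₁ G' hG')

theorem exists_unforced_supp_eq [Finite V] {𝓘 : Set (Set V)} {G : DAG V}
    (H : (G.essentialGraph 𝓘).ChainComponent) :
    ∃ H' : (G.unforced 𝓘).ConnectedComponent, H'.supp = H.supp := by
  have aux : ∀ U : SimpleGraph V, U = G.unforced 𝓘 → ∀ H : U.ConnectedComponent,
      ∃ H' : (G.unforced 𝓘).ConnectedComponent, H'.supp = H.supp := by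
    rintro _ rfl H
    exact ⟨H, rfl⟩
  exact aux _ (essentialGraph_und 𝓘 G) H

end DAG

theorem mainTheorem12 {V : Type*} [Finite V] (G : DAG V) (𝓘 𝓘' : Set (Set V))
    (hdisj : 𝓘 ∩ 𝓘' = ∅) (H : (G.essentialGraph 𝓘).ChainComponent) :
    (G.essentialGraph (𝓘 ∪ 𝓘')).induce H.supp =
      (G.induce H.supp).essentialGraph
        {T : Set H.supp | ∃ S ∈ 𝓘', T = {v : H.supp | (v : V) ∈ S}} := by
  obtain ⟨H', hH'⟩ := DAG.exists_unforced_supp_eq H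
  rw [← hH']
  refine DAG.essentialGraph_induce_eq (fun G' hG' => ?_) fun D hD => ?_
  · exact DAG.iMarkovEquiv_iff.2
      ((DAG.iMarkovEquiv_iff.1 hG').induce Set.subset_union_right _)
  · obtain ⟨G', hG', hD'⟩ := DAG.exists_iPatternEq_induce_eq H' (DAG.iMarkovEquiv_iff.1 hD)
    exact ⟨G', DAG.iMarkovEquiv_iff.2 hG', hD'⟩
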